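/- For $n\ge 2$ let $B_n$ be Artin's braid group on $n$ strands, generated by $\sigma_1,\dots,\sigma_{n-1}$ subject to the relations $\sigma_i\sigma_j=\sigma_j\sigma_i$ for $|i-j|\ge 2$ and $\sigma_i\sigma_{i+1}\sigma_i=\sigma_{i+1}\sigma_i\sigma_{i+1}$ for $1\le i\le n-2$. Let $\pi\colon B_n\to\mathfrak S_n$ be the canonical epimorphism sending $\sigma_i$ to the transposition $(i\;\,i+1)$, let $P_n=\ker\pi$ be the pure braid group and, for a subgroup $G\le\mathfrak S_n$, put $B_n^G=\pi^{-1}(G)$. Write $\mathcal Z(H)$ for the centre of a group $H$. For every $n\ge2$ and every subgroup $G\le\mathfrak S_n$, the centre $\mathcal Z(B_n^G)$ is infinite cyclic. Furthermore, when $n\ge 3$ we have \[\mathcal Z(P_n)=\mathcal Z(B_n^G)=\mathcal Z(B_n)\] as subgroups of $B_n$, and all of these groups are generated by the full twist \[\Delta^2=\bigl((\sigma_1\cdots\sigma_{n-1})(\sigma_1\cdots\sigma_{n-2})\cdots(\sigma_1\sigma_2)\sigma_1\bigr)^2=(\sigma_1\cdots\sigma_{n-1})^n.\] -/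

import Mathlib

/-- The relators of Artin's presentation of the braid group on `n` strands, in the free group on
`n - 1` letters. Letter `i : Fin (n - 1)` (counted from `0`) stands for `σ_{i+1}`. -/
def braidRelators (n : ℕ) : Set (FreeGroup (Fin (n - 1))) :=
  -- far commutativity: `σ_i σ_j = σ_j σ_i` whenever `|i - j| ≥ 2`
  {r | ∃ i j : Fin (n - 1), (i : ℕ) + 2 ≤ (j : ℕ) ∧
      r = (FreeGroup.of i * FreeGroup.of j) * (FreeGroup.of j * FreeGroup.of i)⁻¹} ∪
  -- the braid relation: `σ_i σ_{i+1} σ_i = σ_{i+1} σ_i σ_{i+1}`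
  {r | ∃ i j : Fin (n - 1), (i : ℕ) + 1 = (j : ℕ) ∧
      r = (FreeGroup.of i * FreeGroup.of j * FreeGroup.of i) *
        (FreeGroup.of j * FreeGroup.of i * FreeGroup.of j)⁻¹}

/-- Artin's (full) braid group `B_n` on `n` strands. -/
abbrev BraidGroup (n : ℕ) : Type := PresentedGroup (braidRelators n)

/-- The standard generator `σ_{i+1}` of `B_n`, which crosses strands number `i + 1` and `i + 2`. -/
def braidSigma (n : ℕ) (i : Fin (n - 1)) : BraidGroup n := PresentedGroup.of i

/-- The adjacent transposition of the positions `i` and `i + 1` (counted from `0`). -/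
def adjSwap (n : ℕ) (i : Fin (n - 1)) : Equiv.Perm (Fin n) :=
  Equiv.swap ⟨(i : ℕ), by omega⟩ ⟨(i : ℕ) + 1, by omega⟩

theorem swap_braid_relation {α : Type*} [DecidableEq α] {a b c : α}
    (hab : a ≠ b) (hac : a ≠ c) (hbc : b ≠ c) :
    Equiv.swap a b * Equiv.swap b c * Equiv.swap a b =
      Equiv.swap b c * Equiv.swap a b * Equiv.swap b c := by
  rw [Equiv.swap_mul_swap_mul_swap hab hac, Equiv.swap_comm c a,
    ← Equiv.swap_mul_swap_mul_swap hbc.symm hac.symm, Equiv.swap_comm b a, Equiv.swap_comm c b]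

theorem adjSwap_relators (n : ℕ) :
    ∀ r ∈ braidRelators n, FreeGroup.lift (adjSwap n) r = 1 := by
  rintro r (⟨i, j, hij, rfl⟩ | ⟨i, j, hij, rfl⟩)
  · simp only [map_mul, map_inv, FreeGroup.lift_apply_of, mul_inv_eq_one]
    refine (Equiv.Perm.disjoint_swap_swap ?_).commute.eq
    simp [Fin.ext_iff]
    omega
  · obtain ⟨i, hi⟩ := i
    obtain ⟨j, hj⟩ := j
    obtain rfl : i + 1 = j := hij
    simp only [map_mul, map_inv, FreeGroup.lift_apply_of, mul_inv_eq_one, adjSwap]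
    exact swap_braid_relation (by simp) (by simp [Fin.ext_iff]; omega) (by simp)

/-- The canonical projection `π : B_n → 𝔖_n`, which sends `σ_i` to the transposition `(i i+1)`. -/
def braidPerm (n : ℕ) : BraidGroup n →* Equiv.Perm (Fin n) :=
  PresentedGroup.toGroup (adjSwap_relators n)

/-- The pure braid group `P_n`. -/
def pureBraidGroup (n : ℕ) : Subgroup (BraidGroup n) := (braidPerm n).ker

/-- The group `B_n^G = π⁻¹(G)` of `G`-braids, for a subgroup `G` of the symmetric group. -/
def gBraidGroup {n : ℕ} (G : Subgroup (Equiv.Perm (Fin n))) : Subgroup (BraidGroup n) :=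
  G.comap (braidPerm n)

/-- The centre `Z(H)` of a subgroup `H` of a group `A`, as a subgroup of `A`. -/
def centreIn {A : Type*} [Group A] (H : Subgroup A) : Subgroup A :=
  (Subgroup.center H).map H.subtype

/-- The word `σ_1 σ_2 ⋯ σ_k` in `B_n`, for `k ≤ n - 1`. -/
def ascendingBraid (n k : ℕ) : BraidGroup n :=
  (((List.finRange (n - 1)).take k).map (braidSigma n)).prod

/-- The half twist `Δ = (σ_1 ⋯ σ_{n-1}) (σ_1 ⋯ σ_{n-2}) ⋯ (σ_1 σ_2) σ_1`. -/
def halfTwist (n : ℕ) : BraidGroup n :=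
  ((List.range (n - 1)).map (fun j => ascendingBraid n (n - 1 - j))).prod

/-!
The centre of a group `H` with `P_n ≤ H ≤ B_n` consists of braids that centralise `P_n`, and it
contains the full twist `Δ²`, which is pure and central in `B_n`. For `n ≥ 3` it remains to see that
the centraliser of `P_n` in `B_n` is generated by `Δ²`. The exponent sum shows that `Δ²` has
infinite order, and `B_2` is cyclic, which settles `n = 2`.

The tool is the combing of braids: the stabiliser of the last strand in `B_{m+1}` is the semidirect
product `F_m ⋊ B_m` of `B_m` with the free group of rank `m` of the loops of the last strand, on
which `B_m` acts by Artin's automorphisms. Let `M_k` be the braid `σ_k ⋯ σ_{m-1}`, which moves the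
last strand to position `k`. Rewriting `σ_i M_k` as `M_{k'} c(i, k)` with `c(i, k)` in the
stabiliser yields two facts. The `M_k` times the image of `F_m ⋊ B_m` exhaust `B_{m+1}`
(`mul_moveLast_mul_combToBraid`), so that `F_m ⋊ B_m` maps onto the stabiliser. Conversely, the same
formulas define an action of `B_{m+1}` on `Fin (m + 1) × (F_m ⋊ B_m)` (`combAction`), a copy of the
left regular action, which shows that the map from `F_m ⋊ B_m` to `B_{m+1}` is injective
(`combToBraid_injective`). No presentation of a subgroup of `B_{m+1}` is needed.

A braid `z` that centralises `P_n` is pure if `n ≥ 3`: the cocycle of `combAction` at `σ_i ^ 2`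
tells the positions `i` and `i + 1` from the others, and `z` has to respect this distinction for
all `i` (`mem_pureBraidGroup_of_centralises`). That a pure `z` which centralises `P_{m+1}` is a power of
`Δ²` follows by induction from `m = 1` (`mem_zpowers_of_mem_pureBraidGroup`): the component of `z`
in `B_m` centralises `P_m`, so it is a power of the full twist on `m` strands. The full twist on
`m + 1` strands maps to that on `m` strands, hence `z` times a power of it lies in `F_m`; as it
commutes with `F_m`, where `m ≥ 2`, it is trivial.
-/

/-! ### Centre of a free group -/

theorem FreeGroup.eq_one_of_commute_of {α : Type*} [Nontrivial α] {f : FreeGroup α}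
    (hf : ∀ a, f * FreeGroup.of a = FreeGroup.of a * f) : f = 1 := by
  classical
  by_contra hne
  obtain ⟨⟨i, b⟩, t, hw⟩ := List.exists_cons_of_ne_nil (mt FreeGroup.toWord_eq_nil_iff.1 hne)
  obtain ⟨a, ha⟩ := exists_ne i
  -- for a letter `a` other than the first letter of `f`, the word of `a * f` is `a` followed by
  -- the word of `f`; it would also have to be the word of `f` followed by `a`
  have h1 : (FreeGroup.of a * f).toWord = (a, true) :: f.toWord := by
    rw [FreeGroup.toWord_mul, FreeGroup.toWord_of, List.singleton_append, FreeGroup.reduce.cons,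
      FreeGroup.reduce_toWord, hw]
    simp [ha]
  have h2 : (f * FreeGroup.of a).toWord = f.toWord ++ [(a, true)] := by
    have h := FreeGroup.toWord_mul_sublist f (FreeGroup.of a)
    rw [FreeGroup.toWord_of] at h
    refine h.eq_of_length ?_
    rw [hf, h1]
    simp
  rw [hf, h1, hw] at h2
  simp [ha] at h2

/-! ### Sequences satisfying the braid relations -/

/-- The first `N` terms of the sequence `s` satisfy the relations of Artin's generators
`σ_1, …, σ_N`; the later terms are arbitrary. -/
structure IsBraidSeq {G : Type*} [Group G] (N : ℕ) (s : ℕ → G) : Prop where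
  comm : ∀ i j, i + 2 ≤ j → j < N → s i * s j = s j * s i
  braid : ∀ i, i + 1 < N → s i * s (i + 1) * s i = s (i + 1) * s i * s (i + 1)

section Words

variable {G : Type*} [Group G]

/-- The product `s_0 s_1 ⋯ s_{k-1}`. -/
def ascProd (s : ℕ → G) : ℕ → G
  | 0 => 1
  | k + 1 => ascProd s k * s k

/-- The product `s_{k-1} ⋯ s_1 s_0`. -/
def descProd (s : ℕ → G) : ℕ → G
  | 0 => 1
  | k + 1 => s k * descProd s k

/-- The half twist on the first `k` strands, a word in `s_0, …, s_{k-2}`. -/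
def garside (s : ℕ → G) : ℕ → G
  | 0 => 1
  | k + 1 => ascProd s k * garside s k

/-- The product `s_k s_{k-1} ⋯` with `j` factors; it is used for `j ≤ k + 1` only. -/
def descSegment (s : ℕ → G) : ℕ → ℕ → G
  | _, 0 => 1
  | k, j + 1 => s k * descSegment s (k - 1) j

theorem map_ascProd {H : Type*} [Group H] (f : G →* H) {s : ℕ → G} {t : ℕ → H} {k : ℕ}
    (h : ∀ i < k, f (s i) = t i) : f (ascProd s k) = ascProd t k := by
  induction k with
  | zero => simp [ascProd]
  | succ k ih => simp [ascProd, ih fun i hi => h i (by omega), h k (by omega)]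

theorem map_garside {H : Type*} [Group H] (f : G →* H) {s : ℕ → G} {t : ℕ → H} {k : ℕ}
    (h : ∀ i, i + 1 < k → f (s i) = t i) : f (garside s k) = garside t k := by
  induction k with
  | zero => simp [garside]
  | succ k ih =>
    simp only [garside, map_mul, ih fun i hi => h i (by omega)]
    rw [map_ascProd f fun i hi => h i (by omega)]

theorem prod_range_map_ascProd (s : ℕ → G) (k : ℕ) :
    ((List.range k).map fun j => ascProd s (k - j)).prod = garside s (k + 1) := by
  induction k with
  | zero => simp [garside, ascProd]
  | succ k ih =>
    rw [List.range_succ_eq_map, List.map_cons, List.prod_cons, List.map_map, garside, ← ih]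
    congr 2
    refine List.map_congr_left fun j _ => ?_
    simp

theorem descProd_mul_ascProd_of_sq_eq_one {s : ℕ → G} {k : ℕ} (h : ∀ i < k, s i * s i = 1) :
    descProd s k * ascProd s k = 1 := by
  induction k with
  | zero => simp [ascProd, descProd]
  | succ k ih =>
    have := ih fun i hi => h i (by omega)
    calc s k * descProd s k * (ascProd s k * s k)
        = s k * (descProd s k * ascProd s k) * s k := by group
      _ = 1 := by rw [this, mul_one, h k (by omega)]

theorem descSegment_eq_descProd (s : ℕ → G) (k : ℕ) :
    descSegment s k (k + 1) = descProd s (k + 1) := by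
  induction k with
  | zero => simp [descSegment, descProd]
  | succ k ih => rw [descSegment, descProd, ← ih]; rfl

namespace IsBraidSeq

variable {N : ℕ} {s : ℕ → G} (hs : IsBraidSeq N s)
include hs

theorem commute_ascProd {j k : ℕ} (hk : k < j) (hj : j < N) : Commute (s j) (ascProd s k) := by
  induction k with
  | zero => exact Commute.one_right _
  | succ k ih => exact (ih (by omega)).mul_right (hs.comm k j (by omega) hj).symm

theorem commute_descProd {j k : ℕ} (hk : k < j) (hj : j < N) : Commute (s j) (descProd s k) := by
  induction k with
  | zero => exact Commute.one_right _
  | succ k ih => exact Commute.mul_right (hs.comm k j (by omega) hj).symm (ih (by omega))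

theorem commute_garside {j k : ℕ} (hk : k ≤ j) (hj : j < N) : Commute (s j) (garside s k) := by
  induction k with
  | zero => exact Commute.one_right _
  | succ k ih => exact (hs.commute_ascProd (by omega) hj).mul_right (ih (by omega))

theorem succ_mul_ascProd {i k : ℕ} (hi : i + 1 < k) (hk : k ≤ N) :
    s (i + 1) * ascProd s k = ascProd s k * s i := by
  induction k with
  | zero => omega
  | succ k ih =>
    rcases Nat.lt_or_ge (i + 1) k with h | h
    · rw [ascProd, ← mul_assoc, ih h (by omega), mul_assoc, mul_assoc,
        hs.comm i k (by omega) (by omega)]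
    · obtain rfl : k = i + 1 := by omega
      have hc := (hs.commute_ascProd (j := i + 1) (k := i) (by omega) (by omega)).eq
      calc s (i + 1) * (ascProd s i * s i * s (i + 1))
          = s (i + 1) * ascProd s i * (s i * s (i + 1)) := by group
        _ = ascProd s i * (s (i + 1) * s i * s (i + 1)) := by rw [hc]; group
        _ = ascProd s i * s i * s (i + 1) * s i := by rw [← hs.braid i (by omega)]; group

theorem mul_descProd {i k : ℕ} (hi : i + 1 < k) (hk : k ≤ N) :
    s i * descProd s k = descProd s k * s (i + 1) := by
  induction k with
  | zero => omega
  | succ k ih =>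
    rcases Nat.lt_or_ge (i + 1) k with h | h
    · rw [descProd, mul_assoc, ← ih h (by omega), ← mul_assoc, ← mul_assoc,
        hs.comm i k (by omega) (by omega)]
    · obtain rfl : k = i + 1 := by omega
      have hc := (hs.commute_descProd (j := i + 1) (k := i) (by omega) (by omega)).eq
      calc s i * (s (i + 1) * (s i * descProd s i))
          = s i * s (i + 1) * s i * descProd s i := by group
        _ = s (i + 1) * s i * (s (i + 1) * descProd s i) := by rw [hs.braid i (by omega)]; group
        _ = s (i + 1) * (s i * descProd s i) * s (i + 1) := by rw [hc]; group

theorem garside_succ {k : ℕ} (hk : k ≤ N) :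
    garside s (k + 1) = garside s k * descProd s k := by
  induction k with
  | zero => simp [garside, ascProd, descProd]
  | succ k ih =>
    have hc := (hs.commute_garside (j := k) (k := k) le_rfl (by omega)).eq
    calc ascProd s (k + 1) * garside s (k + 1)
        = ascProd s k * s k * (garside s k * descProd s k) := by rw [ih (by omega)]; rfl
      _ = ascProd s k * (s k * garside s k) * descProd s k := by group
      _ = ascProd s k * garside s k * (s k * descProd s k) := by rw [hc]; group

theorem descSegment_mul_ascProd {j k K : ℕ} (hj : j ≤ k) (hk : k ≤ K) (hK : K < N) :
    descSegment s k j * ascProd s (K + 1) = ascProd s (K + 1) * descSegment s (k - 1) j := by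
  induction j generalizing k with
  | zero => simp [descSegment]
  | succ j ih =>
    obtain ⟨l, rfl⟩ : ∃ l, k = l + 1 := ⟨k - 1, by omega⟩
    rw [descSegment, descSegment, mul_assoc, ih (by omega) (by omega), ← mul_assoc,
      hs.succ_mul_ascProd (by omega) (by omega), mul_assoc]
    rfl

theorem ascProd_succ_pow {j k : ℕ} (hj : j ≤ k + 1) (hk : k < N) :
    ascProd s (k + 1) ^ j = ascProd s k ^ j * descSegment s k j := by
  induction j with
  | zero => simp [descSegment]
  | succ j ih =>
    rw [pow_succ, ih (by omega), mul_assoc, hs.descSegment_mul_ascProd (by omega) le_rfl hk,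
      pow_succ, ascProd, descSegment]
    group

/-- The two expressions for the full twist agree. -/
theorem garside_sq {k : ℕ} (hk : k ≤ N) : garside s (k + 1) ^ 2 = ascProd s k ^ (k + 1) := by
  induction k with
  | zero => simp [garside, ascProd]
  | succ k ih =>
    calc garside s (k + 2) ^ 2
        = ascProd s (k + 1) * garside s (k + 1) * (garside s (k + 1) * descProd s (k + 1)) := by
          rw [← hs.garside_succ hk, sq]; rfl
      _ = ascProd s (k + 1) * (garside s (k + 1) ^ 2 * descProd s (k + 1)) := by rw [sq]; group
      _ = ascProd s (k + 1) ^ (k + 2) := by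
          rw [ih (by omega), ← descSegment_eq_descProd, ← hs.ascProd_succ_pow le_rfl (by omega),
            ← pow_succ']

theorem commute_descProd_mul_ascProd {i k : ℕ} (hi : i + 1 < k) (hk : k ≤ N) :
    Commute (s i) (descProd s k * ascProd s k) := by
  show s i * (descProd s k * ascProd s k) = _
  rw [← mul_assoc, hs.mul_descProd hi hk, mul_assoc, hs.succ_mul_ascProd hi hk, mul_assoc]

theorem garside_succ_sq {k : ℕ} (hk : k ≤ N) :
    garside s (k + 1) ^ 2 = descProd s k * ascProd s k * garside s k ^ 2 := by
  have hc : ∀ l ≤ k, Commute (descProd s k * ascProd s k) (garside s l) := by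
    have ha : ∀ l < k, Commute (descProd s k * ascProd s k) (ascProd s l) := by
      intro l hl
      induction l with
      | zero => exact Commute.one_right _
      | succ l ih =>
        exact (ih (by omega)).mul_right (hs.commute_descProd_mul_ascProd (by omega) hk).symm
    intro l hl
    induction l with
    | zero => exact Commute.one_right _
    | succ l ih => exact (ha l (by omega)).mul_right (ih (by omega))
  have h1 : garside s (k + 1) ^ 2 = garside s k * (descProd s k * ascProd s k) * garside s k := by
    calc garside s (k + 1) ^ 2 = garside s k * descProd s k * (ascProd s k * garside s k) := by
          rw [← hs.garside_succ hk, sq]; rfl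
      _ = _ := by group
  rw [h1, ← (hc k le_rfl).eq, sq]
  group

/-- The full twist is central: by induction it commutes with all generators but the last one,
and, being a power of `s_0 ⋯ s_k`, it commutes with an element that conjugates the last but one
generator into the last one. -/
theorem commute_garside_sq {i k : ℕ} (hi : i < k) (hk : k ≤ N) :
    Commute (s i) (garside s (k + 1) ^ 2) := by
  induction k generalizing i with
  | zero => omega
  | succ k ih =>
    have hlow : ∀ i < k, Commute (s i) (garside s (k + 2) ^ 2) := fun i hi => by
      rw [hs.garside_succ_sq hk]
      exact (hs.commute_descProd_mul_ascProd (by omega) hk).mul_right (ih hi (by omega))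
    rcases Nat.lt_or_ge i k with h | h
    · exact hlow i h
    obtain rfl : i = k := by omega
    rcases i with _ | j
    · simp [garside, ascProd]
    · have hA : Commute (ascProd s (j + 1 + 1)) (garside s (j + 1 + 2) ^ 2) := by
        rw [hs.garside_sq hk]
        exact (Commute.refl _).pow_right _
      have hj : s (j + 1) = ascProd s (j + 1 + 1) * s j * (ascProd s (j + 1 + 1))⁻¹ :=
        eq_mul_inv_of_mul_eq (hs.succ_mul_ascProd (by omega) hk)
      rw [hj]
      exact (hA.mul_left (hlow j (by omega))).mul_left hA.inv_left

end IsBraidSeq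

end Words

/-! ### Artin's generators indexed by the natural numbers -/

/-- Artin's generators of `B_n`, counted from `0` and continued by `1` beyond the last one. -/
def sig (n i : ℕ) : BraidGroup n :=
  if h : i < n - 1 then braidSigma n ⟨i, h⟩ else 1

theorem sig_of_lt {n i : ℕ} (h : i < n - 1) : sig n i = braidSigma n ⟨i, h⟩ := dif_pos h

theorem isBraidSeq_sig (n : ℕ) : IsBraidSeq (n - 1) (sig n) where
  comm i j hij hj := by
    rw [sig_of_lt hj, sig_of_lt (by omega)]
    exact PresentedGroup.mk_eq_mk_of_mul_inv_mem (Or.inl ⟨_, _, hij, rfl⟩)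
  braid i hi := by
    rw [sig_of_lt hi, sig_of_lt (by omega)]
    exact PresentedGroup.mk_eq_mk_of_mul_inv_mem (Or.inr ⟨_, _, rfl, rfl⟩)

/-- The homomorphism from `B_n` that maps Artin's generators to a sequence which satisfies the
braid relations. -/
def braidLift {n : ℕ} {G : Type*} [Group G] {s : ℕ → G} (hs : IsBraidSeq (n - 1) s) :
    BraidGroup n →* G :=
  PresentedGroup.toGroup (f := fun i : Fin (n - 1) => s i) <| by
    rintro r (⟨i, j, hij, rfl⟩ | ⟨i, j, hij, rfl⟩)
    · simp only [map_mul, map_inv, FreeGroup.lift_apply_of, mul_inv_eq_one]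
      exact hs.comm i j hij j.2
    · simp only [map_mul, map_inv, FreeGroup.lift_apply_of, mul_inv_eq_one, ← hij]
      exact hs.braid i (by omega)

theorem braidLift_sig {n : ℕ} {G : Type*} [Group G] {s : ℕ → G} (hs : IsBraidSeq (n - 1) s)
    {i : ℕ} (hi : i < n - 1) : braidLift hs (sig n i) = s i := by
  rw [sig_of_lt hi]
  exact PresentedGroup.toGroup.of _

theorem closure_sig (n : ℕ) : Subgroup.closure {g | ∃ i < n - 1, sig n i = g} = ⊤ := by
  rw [← PresentedGroup.closure_range_of (braidRelators n)]
  congr 1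
  ext g
  constructor
  · rintro ⟨i, hi, rfl⟩
    exact ⟨⟨i, hi⟩, (sig_of_lt hi).symm⟩
  · rintro ⟨i, rfl⟩
    exact ⟨i, i.2, sig_of_lt i.2⟩

/-- A property of braids which is compatible with products and inverses holds for all braids if it
holds for Artin's generators. -/
theorem braid_induction {n : ℕ} {p : BraidGroup n → Prop} (sig : ∀ i < n - 1, p (sig n i))
    (one : p 1) (mul : ∀ a b, p a → p b → p (a * b)) (inv : ∀ a, p a → p a⁻¹)
    (b : BraidGroup n) : p b := by
  have hb : b ∈ Subgroup.closure {g | ∃ i < n - 1, _root_.sig n i = g} := by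
    rw [closure_sig]
    trivial
  induction hb using Subgroup.closure_induction with
  | mem g hg =>
    obtain ⟨i, hi, rfl⟩ := hg
    exact sig i hi
  | one => exact one
  | mul a b _ _ ha hb => exact mul a b ha hb
  | inv a _ ha => exact inv a ha

theorem ascendingBraid_eq {n k : ℕ} (hk : k ≤ n - 1) :
    ascendingBraid n k = ascProd (sig n) k := by
  induction k with
  | zero => simp [ascendingBraid, ascProd]
  | succ k ih =>
    rw [ascProd, ← ih (by omega), sig_of_lt (by omega), ascendingBraid, ascendingBraid,
      List.take_add_one]
    simp [show k < n - 1 by omega]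

theorem halfTwist_eq {n : ℕ} (hn : 1 ≤ n) : halfTwist n = garside (sig n) n := by
  obtain ⟨m, rfl⟩ : ∃ m, n = m + 1 := ⟨n - 1, by omega⟩
  rw [← prod_range_map_ascProd, halfTwist]
  congr 1
  exact List.map_congr_left fun j _ => ascendingBraid_eq (by omega)

theorem halfTwist_sq_eq {n : ℕ} (hn : 1 ≤ n) :
    halfTwist n ^ 2 = ascendingBraid n (n - 1) ^ n := by
  obtain ⟨m, rfl⟩ : ∃ m, n = m + 1 := ⟨n - 1, by omega⟩
  rw [halfTwist_eq hn, ascendingBraid_eq le_rfl]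
  exact (isBraidSeq_sig (m + 1)).garside_sq le_rfl

theorem halfTwist_sq_mem_center {n : ℕ} (hn : 1 ≤ n) :
    halfTwist n ^ 2 ∈ Subgroup.center (BraidGroup n) := by
  obtain ⟨m, rfl⟩ : ∃ m, n = m + 1 := ⟨n - 1, by omega⟩
  rw [halfTwist_eq hn, Subgroup.mem_center_iff]
  intro g
  change Commute g _
  induction g using braid_induction with
  | sig i hi => exact (isBraidSeq_sig (m + 1)).commute_garside_sq hi le_rfl
  | one => exact Commute.one_left _
  | mul a b ha hb => exact ha.mul_left hb
  | inv a ha => exact ha.inv_left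

/-! ### The permutation and the exponent sum of a braid -/

/-- The adjacent transpositions of `Fin n`, continued by `1`. -/
def swapSeq (n i : ℕ) : Equiv.Perm (Fin n) :=
  if h : i < n - 1 then adjSwap n ⟨i, h⟩ else 1

theorem braidPerm_sig (n i : ℕ) : braidPerm n (sig n i) = swapSeq n i := by
  unfold sig swapSeq
  split
  · exact PresentedGroup.toGroup.of _
  · exact map_one _

theorem swapSeq_sq (n i : ℕ) : swapSeq n i * swapSeq n i = 1 := by
  unfold swapSeq
  split
  · exact Equiv.swap_mul_self _ _
  · simp

theorem coe_swapSeq_apply {n i : ℕ} (hi : i < n - 1) (k : Fin n) :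
    (swapSeq n i k : ℕ) = if (k : ℕ) = i then i + 1 else if (k : ℕ) = i + 1 then i else k := by
  rw [swapSeq, dif_pos hi, adjSwap, Equiv.swap_apply_def]
  simp only [Fin.ext_iff]
  split_ifs <;> rfl

theorem isBraidSeq_swapSeq (n : ℕ) : IsBraidSeq (n - 1) (swapSeq n) where
  comm i j hij hj := by
    simpa [braidPerm_sig] using congrArg (braidPerm n) ((isBraidSeq_sig n).comm i j hij hj)
  braid i hi := by
    simpa [braidPerm_sig] using congrArg (braidPerm n) ((isBraidSeq_sig n).braid i hi)

theorem sig_sq_mem_pureBraidGroup (n i : ℕ) : sig n i * sig n i ∈ pureBraidGroup n := by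
  rw [pureBraidGroup, MonoidHom.mem_ker, map_mul, braidPerm_sig, swapSeq_sq]

theorem halfTwist_sq_mem_pureBraidGroup {n : ℕ} (hn : 1 ≤ n) :
    halfTwist n ^ 2 ∈ pureBraidGroup n := by
  obtain ⟨m, rfl⟩ : ∃ m, n = m + 1 := ⟨n - 1, by omega⟩
  rw [pureBraidGroup, MonoidHom.mem_ker, halfTwist_eq hn, map_pow,
    map_garside (braidPerm (m + 1)) fun i _ => braidPerm_sig _ i]
  have h : ∀ k ≤ m, garside (swapSeq (m + 1)) (k + 1) ^ 2 = 1 := by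
    intro k hk
    induction k with
    | zero => simp [garside, ascProd]
    | succ k ih =>
      rw [(isBraidSeq_swapSeq (m + 1)).garside_succ_sq hk, ih (by omega), mul_one]
      exact descProd_mul_ascProd_of_sq_eq_one fun i _ => swapSeq_sq _ i
  exact h m le_rfl

/-- The exponent sum `B_n → ℤ`, which maps every generator to `1`. -/
def expSum (n : ℕ) : BraidGroup n →* Multiplicative ℤ :=
  braidLift (s := fun _ => Multiplicative.ofAdd 1) ⟨fun _ _ _ _ => rfl, fun _ _ => rfl⟩

theorem expSum_sig {n i : ℕ} (hi : i < n - 1) : expSum n (sig n i) = Multiplicative.ofAdd 1 :=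
  braidLift_sig _ hi

theorem halfTwist_sq_zpow_injective {n : ℕ} (hn : 2 ≤ n) :
    Function.Injective fun k : ℤ => (halfTwist n ^ 2) ^ k := by
  have hA : ∀ k ≤ n - 1, expSum n (ascProd (sig n) k) = Multiplicative.ofAdd (k : ℤ) := by
    intro k hk
    induction k with
    | zero => simp [ascProd]
    | succ k ih =>
      rw [ascProd, map_mul, ih (by omega), expSum_sig (by omega), ← ofAdd_add]
      push_cast
      rfl
  intro a b hab
  have h := congrArg (fun g => Multiplicative.toAdd (expSum n g)) hab
  simp only [map_zpow, halfTwist_sq_eq (show 1 ≤ n by omega), ascendingBraid_eq le_rfl, map_pow,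
    hA _ le_rfl, toAdd_zpow, toAdd_pow, toAdd_ofAdd, smul_eq_mul, nsmul_eq_mul] at h
  have h0 : (n : ℤ) * ((n - 1 : ℕ) : ℤ) ≠ 0 := by
    have : n - 1 ≠ 0 := by omega
    positivity
  exact mul_right_cancel₀ h0 h

/-! ### Artin's action of the braid group on a free group -/

section Artin

variable {α : Type*} [DecidableEq α]

/-- Artin's automorphism of the free group for a pair of letters `a ≠ b`: it maps `b` to `a` and
`a` to `a⁻¹ b a`, and fixes the other letters. -/
def artinAut (a b : α) (hab : a ≠ b) : MulAut (FreeGroup α) :=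
  MonoidHom.toMulEquiv
    (FreeGroup.lift fun x => if x = b then FreeGroup.of a
      else if x = a then (FreeGroup.of a)⁻¹ * FreeGroup.of b * FreeGroup.of a else FreeGroup.of x)
    (FreeGroup.lift fun x => if x = a then FreeGroup.of b
      else if x = b then FreeGroup.of b * FreeGroup.of a * (FreeGroup.of b)⁻¹ else FreeGroup.of x)
    (by
      ext x
      by_cases hb : x = b
      · simp [hb]
      · by_cases ha : x = a <;> simp [ha, hb, hab, hab.symm, mul_assoc])
    (by
      ext x
      by_cases ha : x = a
      · simp [ha]
      · by_cases hb : x = b <;> simp [ha, hb, hab, hab.symm, mul_assoc])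

theorem artinAut_of (a b : α) (hab : a ≠ b) (x : α) :
    artinAut a b hab (FreeGroup.of x) = if x = b then FreeGroup.of a
      else if x = a then (FreeGroup.of a)⁻¹ * FreeGroup.of b * FreeGroup.of a
      else FreeGroup.of x := by
  simp [artinAut]

omit [DecidableEq α] in
theorem mulAut_freeGroup_ext {f g : MulAut (FreeGroup α)}
    (h : ∀ x, f (FreeGroup.of x) = g (FreeGroup.of x)) : f = g := by
  have : f.toMonoidHom = g.toMonoidHom := FreeGroup.ext_hom _ _ h
  ext x
  exact DFunLike.congr_fun this x

theorem artinAut_comm {a b c d : α} (hab : a ≠ b) (hcd : c ≠ d) (hac : a ≠ c) (had : a ≠ d)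
    (hbc : b ≠ c) (hbd : b ≠ d) :
    artinAut a b hab * artinAut c d hcd = artinAut c d hcd * artinAut a b hab := by
  refine mulAut_freeGroup_ext fun x => ?_
  simp only [MulAut.mul_apply, artinAut_of]
  by_cases h1 : x = a
  · subst h1; simp [artinAut_of, *]
  by_cases h2 : x = b
  · subst h2; simp [artinAut_of, *]
  by_cases h3 : x = c
  · subst h3; simp [artinAut_of, *, Ne.symm hac, Ne.symm had, Ne.symm hbc, Ne.symm hbd]
  by_cases h4 : x = d
  · subst h4; simp [artinAut_of, *, Ne.symm hac, Ne.symm had, Ne.symm hbc, Ne.symm hbd]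
  simp [artinAut_of, *]

theorem artinAut_braid {a b c : α} (hab : a ≠ b) (hbc : b ≠ c) (hac : a ≠ c) :
    artinAut a b hab * artinAut b c hbc * artinAut a b hab =
      artinAut b c hbc * artinAut a b hab * artinAut b c hbc := by
  refine mulAut_freeGroup_ext fun x => ?_
  simp only [MulAut.mul_apply, artinAut_of]
  by_cases h1 : x = a
  · subst h1; simp [artinAut_of, *, hac.symm, hbc.symm, mul_assoc]
  by_cases h2 : x = b
  · subst h2; simp [artinAut_of, *, hac.symm, hbc.symm, mul_assoc]
  by_cases h3 : x = c
  · subst h3; simp [artinAut_of, *, hac.symm, hbc.symm]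
  simp [artinAut_of, *]

end Artin

/-- The images of Artin's generators of `B_m` in the automorphism group of the free group on
`m` letters, continued by `1`. -/
def artinSeq (m i : ℕ) : MulAut (FreeGroup (Fin m)) :=
  if h : i < m - 1 then artinAut ⟨i, by omega⟩ ⟨i + 1, by omega⟩ (by simp [Fin.ext_iff]) else 1

theorem isBraidSeq_artinSeq (m : ℕ) : IsBraidSeq (m - 1) (artinSeq m) where
  comm i j hij hj := by
    rw [artinSeq, artinSeq, dif_pos hj, dif_pos (by omega)]
    apply artinAut_comm <;> simp [Fin.ext_iff] <;> omega
  braid i hi := by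
    rw [artinSeq, artinSeq, dif_pos hi, dif_pos (by omega)]
    exact artinAut_braid _ _ (by simp [Fin.ext_iff]; omega)

/-- Artin's action of `B_m` on the free group on `m` letters. -/
def artinHom (m : ℕ) : BraidGroup m →* MulAut (FreeGroup (Fin m)) :=
  braidLift (isBraidSeq_artinSeq m)

/-- The model of the group of the braids on `m + 1` strands that fix the last strand: the loops of
the last strand around the other ones form a free group of rank `m`, on which `B_m` acts. -/
abbrev CombGroup (m : ℕ) : Type := FreeGroup (Fin m) ⋊[artinHom m] BraidGroup m

namespace CombGroup

variable {m : ℕ}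

/-- The generators of the free part, continued by `1`. -/
def loop (m k : ℕ) : CombGroup m :=
  if h : k < m then SemidirectProduct.inl (FreeGroup.of ⟨k, h⟩) else 1

/-- Artin's generators of the braid part, continued by `1`. -/
def sigma (m i : ℕ) : CombGroup m := SemidirectProduct.inr (sig m i)

theorem loop_of_lt {k : ℕ} (h : k < m) :
    loop m k = SemidirectProduct.inl (FreeGroup.of ⟨k, h⟩) := dif_pos h

theorem isBraidSeq_sigma (m : ℕ) : IsBraidSeq (m - 1) (sigma m) where
  comm i j hij hj := by
    simp only [sigma, ← map_mul, (isBraidSeq_sig m).comm i j hij hj]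
  braid i hi := by
    simp only [sigma, ← map_mul, (isBraidSeq_sig m).braid i hi]

theorem sigma_mul_inl {i : ℕ} (hi : i < m - 1) (f : FreeGroup (Fin m)) :
    sigma m i * SemidirectProduct.inl f =
      SemidirectProduct.inl (artinSeq m i f) * sigma m i := by
  have h := SemidirectProduct.inl_aut (φ := artinHom m) (sig m i) f
  have e : artinHom m (sig m i) = artinSeq m i := braidLift_sig _ hi
  rw [e] at h
  rw [h, sigma, mul_assoc, ← map_mul]
  simp

theorem sigma_mul_loop_of_ne {i k : ℕ} (hi : i < m - 1) (h1 : k ≠ i) (h2 : k ≠ i + 1) :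
    sigma m i * loop m k = loop m k * sigma m i := by
  rcases Nat.lt_or_ge k m with hk | hk
  · rw [loop_of_lt hk, sigma_mul_inl hi, artinSeq, dif_pos hi, artinAut_of,
      if_neg (by simpa [Fin.ext_iff] using h2), if_neg (by simpa [Fin.ext_iff] using h1)]
  · simp [loop, show ¬ k < m by omega]

theorem sigma_mul_loop_succ {i : ℕ} (hi : i < m - 1) :
    sigma m i * loop m (i + 1) = loop m i * sigma m i := by
  rw [loop_of_lt (show i + 1 < m by omega), loop_of_lt (show i < m by omega), sigma_mul_inl hi,
    artinSeq, dif_pos hi, artinAut_of, if_pos rfl]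

theorem sigma_mul_loop_self {i : ℕ} (hi : i < m - 1) :
    sigma m i * loop m i = (loop m i)⁻¹ * loop m (i + 1) * loop m i * sigma m i := by
  rw [loop_of_lt (show i + 1 < m by omega), loop_of_lt (show i < m by omega), sigma_mul_inl hi,
    artinSeq, dif_pos hi, artinAut_of, if_neg (by simp [Fin.ext_iff]), if_pos rfl]
  simp [mul_assoc]

end CombGroup

/-! ### The action of the braid group on the translates of the stabiliser of a strand -/

open CombGroup in
/-- The factor `c(i, k)` in `σ_i M_k = M_{s_i k} c(i, k)`, where `M_k = σ_k ⋯ σ_{m-1}` is the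
standard braid that moves the last strand to position `k`. -/
def combFactor (m i k : ℕ) : CombGroup m :=
  if i + 1 < k then sigma m i
  else if i + 1 = k then 1
  else if i = k then loop m k
  else sigma m (i - 1)

section CombAction

open CombGroup

variable {m : ℕ}

theorem combFactor_lt {i k : ℕ} (h : i + 1 < k) : combFactor m i k = sigma m i := if_pos h

theorem combFactor_succ {i k : ℕ} (h : i + 1 = k) : combFactor m i k = 1 := by
  simp [combFactor, h]

theorem combFactor_self {i k : ℕ} (h : i = k) : combFactor m i k = loop m k := by
  simp [combFactor, h]

theorem combFactor_gt {i k : ℕ} (h : k < i) : combFactor m i k = sigma m (i - 1) := by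
  rw [combFactor, if_neg (by omega), if_neg (by omega), if_neg (by omega)]

/-- The action of the `i`-th generator on `Fin (m + 1) × CombGroup m`. The pair `(k, h)` stands for
the braid `M_k h`, and the action for multiplication from the left. -/
def combPerm (m i : ℕ) : Equiv.Perm (Fin (m + 1) × CombGroup m) where
  toFun x := (swapSeq (m + 1) i x.1, combFactor m i x.1 * x.2)
  invFun x := (swapSeq (m + 1) i x.1, (combFactor m i (swapSeq (m + 1) i x.1))⁻¹ * x.2)
  left_inv x := by
    have h := Equiv.Perm.congr_fun (swapSeq_sq (m + 1) i) x.1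
    rw [Equiv.Perm.mul_apply, Equiv.Perm.one_apply] at h
    simp [h]
  right_inv x := by
    have h := Equiv.Perm.congr_fun (swapSeq_sq (m + 1) i) x.1
    rw [Equiv.Perm.mul_apply, Equiv.Perm.one_apply] at h
    simp [h]

theorem combPerm_apply (i : ℕ) (k : Fin (m + 1)) (h : CombGroup m) :
    combPerm m i (k, h) = (swapSeq (m + 1) i k, combFactor m i k * h) := rfl

theorem combFactor_comm {i j : ℕ} (hij : i + 2 ≤ j) (hj : j < m) (k : Fin (m + 1)) :
    combFactor m i (swapSeq (m + 1) j k) * combFactor m j k =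
      combFactor m j (swapSeq (m + 1) i k) * combFactor m i k := by
  rw [coe_swapSeq_apply (show i < m + 1 - 1 by omega),
    coe_swapSeq_apply (show j < m + 1 - 1 by omega)]
  obtain ⟨k, hk⟩ := k
  dsimp only
  rcases Nat.lt_trichotomy k i with h | rfl | h
  · rw [if_neg (by omega), if_neg (by omega), if_neg (by omega), if_neg (by omega),
      combFactor_gt h, combFactor_gt (show k < j by omega)]
    exact (isBraidSeq_sigma m).comm _ _ (by omega) (by omega)
  · rw [if_neg (by omega), if_neg (by omega), if_pos rfl, combFactor_self rfl,
      combFactor_gt (show k < j by omega), combFactor_gt (show k + 1 < j by omega)]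
    exact (sigma_mul_loop_of_ne (by omega) (by omega) (by omega)).symm
  rcases Nat.lt_trichotomy k (i + 1) with h' | rfl | h
  · omega
  · rw [if_neg (by omega), if_neg (by omega), if_neg (by omega), if_pos rfl, combFactor_succ rfl,
      combFactor_gt (show i + 1 < j by omega), combFactor_gt (show i < j by omega)]
    simp
  rw [if_neg (show k ≠ i by omega), if_neg (show k ≠ i + 1 by omega), combFactor_lt h]
  rcases Nat.lt_trichotomy k j with h | rfl | h
  · rw [if_neg (by omega), if_neg (by omega), combFactor_gt h, combFactor_lt (by omega)]
    exact (isBraidSeq_sigma m).comm _ _ (by omega) (by omega)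
  · rw [if_pos rfl, combFactor_self rfl, combFactor_lt (by omega)]
    exact sigma_mul_loop_of_ne (by omega) (by omega) (by omega)
  rcases Nat.lt_trichotomy k (j + 1) with h' | rfl | h
  · omega
  · rw [if_neg (by omega), if_pos rfl, combFactor_succ rfl, combFactor_lt (by omega)]
    simp
  · rw [if_neg (by omega), if_neg (by omega), combFactor_lt h, combFactor_lt (by omega)]
    exact (isBraidSeq_sigma m).comm _ _ (by omega) (by omega)

theorem combFactor_braid {i : ℕ} (hi : i + 1 < m) (k : Fin (m + 1)) :
    combFactor m i (swapSeq (m + 1) (i + 1) (swapSeq (m + 1) i k)) *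
        combFactor m (i + 1) (swapSeq (m + 1) i k) * combFactor m i k =
      combFactor m (i + 1) (swapSeq (m + 1) i (swapSeq (m + 1) (i + 1) k)) *
        combFactor m i (swapSeq (m + 1) (i + 1) k) * combFactor m (i + 1) k := by
  simp only [coe_swapSeq_apply (show i < m + 1 - 1 by omega),
    coe_swapSeq_apply (show i + 1 < m + 1 - 1 by omega)]
  obtain ⟨k, hk⟩ := k
  dsimp only
  rcases Nat.lt_or_ge k i with h | h
  · simp only [show k ≠ i by omega, show k ≠ i + 1 by omega, show k ≠ i + 1 + 1 by omega, if_false]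
    obtain ⟨l, rfl⟩ : ∃ l, i = l + 1 := ⟨i - 1, by omega⟩
    rw [combFactor_gt h, combFactor_gt (show k < l + 1 + 1 by omega)]
    exact (isBraidSeq_sigma m).braid l (by omega)
  rcases Nat.eq_or_lt_of_le h with rfl | h
  · rw [if_pos rfl, if_pos rfl, if_neg (show i ≠ i + 1 by omega),
      if_neg (show i ≠ i + 1 + 1 by omega), if_pos rfl,
      combFactor_lt (show i + 1 < i + 1 + 1 by omega),
      combFactor_self rfl, combFactor_self rfl,
      combFactor_gt (show i < i + 1 by omega), Nat.add_sub_cancel,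
      sigma_mul_loop_succ (by omega), mul_assoc, mul_assoc, sigma_mul_loop_self (by omega)]
    group
  rcases Nat.eq_or_lt_of_le (Nat.succ_le_of_lt h) with h1 | h
  · obtain rfl : k = i + 1 := h1.symm
    simp only [if_pos, if_neg (show i + 1 ≠ i by omega), if_neg (show i ≠ i + 1 by omega),
      if_neg (show i ≠ i + 1 + 1 by omega), if_neg (show i + 1 + 1 ≠ i by omega),
      if_neg (show i + 1 + 1 ≠ i + 1 by omega)]
    rw [combFactor_self rfl, combFactor_succ rfl, combFactor_succ rfl, combFactor_self rfl,
      combFactor_gt (show i < i + 1 by omega), combFactor_lt (show i + 1 < i + 1 + 1 by omega),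
      Nat.add_sub_cancel, mul_one, one_mul, sigma_mul_loop_succ (by omega)]
  rcases Nat.eq_or_lt_of_le (Nat.succ_le_of_lt h) with h1 | h
  · obtain rfl : k = i + 1 + 1 := h1.symm
    simp only [if_pos, if_neg (show i + 1 ≠ i by omega), if_neg (show i + 1 + 1 ≠ i by omega),
      if_neg (show i + 1 + 1 ≠ i + 1 by omega)]
    rw [combFactor_succ rfl, combFactor_succ rfl, combFactor_lt (by omega),
      combFactor_gt (show i < i + 1 by omega), Nat.add_sub_cancel, one_mul, one_mul, mul_one,
      mul_one]
  · simp only [show k ≠ i by omega, show k ≠ i + 1 by omega, show k ≠ i + 1 + 1 by omega, if_false]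
    rw [combFactor_lt (by omega), combFactor_lt (by omega)]
    exact (isBraidSeq_sigma m).braid i (by omega)

end CombAction

theorem isBraidSeq_combPerm (m : ℕ) : IsBraidSeq m (combPerm m) where
  comm i j hij hj := by
    ext1 ⟨k, h⟩
    have e := Equiv.Perm.congr_fun ((isBraidSeq_swapSeq (m + 1)).comm i j hij hj) k
    simp only [Equiv.Perm.mul_apply] at e
    simp only [Equiv.Perm.mul_apply, combPerm_apply]
    rw [e, ← mul_assoc, combFactor_comm hij hj, mul_assoc]
  braid i hi := by
    ext1 ⟨k, h⟩
    have e := Equiv.Perm.congr_fun ((isBraidSeq_swapSeq (m + 1)).braid i hi) k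
    simp only [Equiv.Perm.mul_apply] at e
    simp only [Equiv.Perm.mul_apply, combPerm_apply]
    rw [e, ← mul_assoc, ← mul_assoc, combFactor_braid hi, mul_assoc, mul_assoc]

/-- The action of `B_{m+1}` on `Fin (m + 1) × CombGroup m`, a model of the left regular action. -/
def combAction (m : ℕ) : BraidGroup (m + 1) →* Equiv.Perm (Fin (m + 1) × CombGroup m) :=
  braidLift (isBraidSeq_combPerm m)

/-- The cocycle `B_{m+1} × Fin (m + 1) → CombGroup m` that describes `combAction`. -/
def combCocycle (m : ℕ) (b : BraidGroup (m + 1)) (k : Fin (m + 1)) : CombGroup m :=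
  (combAction m b (k, 1)).2

section CombAction

variable {m : ℕ}

theorem combAction_sig {i : ℕ} (hi : i < m) (k : Fin (m + 1)) (h : CombGroup m) :
    combAction m (sig (m + 1) i) (k, h) = (swapSeq (m + 1) i k, combFactor m i k * h) := by
  rw [combAction, braidLift_sig _ (show i < m + 1 - 1 from hi), combPerm_apply]

theorem combAction_apply (b : BraidGroup (m + 1)) (k : Fin (m + 1)) (h : CombGroup m) :
    combAction m b (k, h) = (braidPerm (m + 1) b k, combCocycle m b k * h) := by
  suffices H : ∃ c : Fin (m + 1) → CombGroup m, ∀ k h,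
      combAction m b (k, h) = (braidPerm (m + 1) b k, c k * h) by
    obtain ⟨c, hc⟩ := H
    rw [combCocycle, hc, hc, mul_one]
  induction b using braid_induction with
  | sig i hi => exact ⟨fun k => combFactor m i k, fun k h => by 
      rw [combAction_sig (show i < m from hi), braidPerm_sig]⟩
  | one => exact ⟨1, fun k h => by simp⟩
  | mul a b ha hb =>
    obtain ⟨c, hc⟩ := ha
    obtain ⟨d, hd⟩ := hb
    refine ⟨fun k => c (braidPerm (m + 1) b k) * d k, fun k h => ?_⟩
    rw [map_mul, Equiv.Perm.mul_apply, hd, hc, map_mul, Equiv.Perm.mul_apply, mul_assoc]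
  | inv a ha =>
    obtain ⟨c, hc⟩ := ha
    refine ⟨fun k => (c ((braidPerm (m + 1) a)⁻¹ k))⁻¹, fun k h => ?_⟩
    rw [map_inv, Equiv.Perm.inv_eq_iff_eq, hc, map_inv]
    simp

theorem combCocycle_mul (a b : BraidGroup (m + 1)) (k : Fin (m + 1)) :
    combCocycle m (a * b) k = combCocycle m a (braidPerm (m + 1) b k) * combCocycle m b k := by
  rw [combCocycle, map_mul, Equiv.Perm.mul_apply, combAction_apply b, combAction_apply a, mul_one]

theorem combCocycle_sig {i : ℕ} (hi : i < m) (k : Fin (m + 1)) :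
    combCocycle m (sig (m + 1) i) k = combFactor m i k := by
  rw [combCocycle, combAction_sig hi, mul_one]

end CombAction

/-! ### The stabiliser of the last strand -/

/-- The braid `M_k = σ_k ⋯ σ_{m-1}` on `m + 1` strands, which moves the last strand to
position `k`. -/
def moveLast (m k : ℕ) : BraidGroup (m + 1) :=
  ((List.range' k (m - k)).map (sig (m + 1))).prod

/-- The pure braid in which the last strand encircles strand `k`. -/
def braidLoop (m k : ℕ) : BraidGroup (m + 1) :=
  (moveLast m (k + 1))⁻¹ * (sig (m + 1) k * sig (m + 1) k) * moveLast m (k + 1)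

section Move

variable {m : ℕ}

theorem moveLast_of_ge {k : ℕ} (h : m ≤ k) : moveLast m k = 1 := by
  simp [moveLast, Nat.sub_eq_zero_of_le h]

theorem moveLast_of_lt {k : ℕ} (h : k < m) :
    moveLast m k = sig (m + 1) k * moveLast m (k + 1) := by
  rw [moveLast, show m - k = (m - (k + 1)) + 1 by omega, List.range'_succ]
  simp [moveLast]

theorem commute_sig_moveLast {i k : ℕ} (h : i + 1 < k) :
    Commute (sig (m + 1) i) (moveLast m k) := by
  obtain ⟨d, hd⟩ : ∃ d, d = m - k := ⟨_, rfl⟩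
  induction d generalizing k with
  | zero =>
    rw [moveLast_of_ge (by omega)]
    exact Commute.one_right _
  | succ d ih =>
    rw [moveLast_of_lt (by omega)]
    exact Commute.mul_right ((isBraidSeq_sig (m + 1)).comm _ _ (by omega) (by omega))
      (ih (by omega) (by omega))

theorem sig_mul_moveLast {i k : ℕ} (h : k ≤ i) (hi : i + 1 < m) :
    sig (m + 1) (i + 1) * moveLast m k = moveLast m k * sig (m + 1) i := by
  obtain ⟨d, hd⟩ : ∃ d, d = i - k := ⟨_, rfl⟩
  induction d generalizing k with
  | zero =>
    obtain rfl : k = i := by omega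
    rw [moveLast_of_lt (by omega), moveLast_of_lt (by omega)]
    calc sig (m + 1) (k + 1) * (sig (m + 1) k * (sig (m + 1) (k + 1) * moveLast m (k + 1 + 1)))
        = sig (m + 1) (k + 1) * sig (m + 1) k * sig (m + 1) (k + 1) * moveLast m (k + 1 + 1) := by
          group
      _ = sig (m + 1) k * sig (m + 1) (k + 1) * (sig (m + 1) k * moveLast m (k + 1 + 1)) := by
          rw [← (isBraidSeq_sig (m + 1)).braid k (by omega)]
          group
      _ = _ := by
          rw [(commute_sig_moveLast (by omega)).eq]
          group
  | succ d ih =>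
    rw [moveLast_of_lt (by omega), ← mul_assoc,
      ← (isBraidSeq_sig (m + 1)).comm k (i + 1) (by omega) (by omega), mul_assoc,
      ih (by omega) (by omega), mul_assoc]

theorem sig_mul_braidLoop_of_ne {i k : ℕ} (hi : i < m - 1) (hk : k < m) (h1 : k ≠ i)
    (h2 : k ≠ i + 1) :
    sig (m + 1) i * braidLoop m k = braidLoop m k * sig (m + 1) i := by
  change Commute _ _
  rcases Nat.lt_or_ge i k with h | h
  · have hc : Commute (sig (m + 1) i) (moveLast m (k + 1)) := commute_sig_moveLast (by omega)
    have hk : Commute (sig (m + 1) i) (sig (m + 1) k) :=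
      (isBraidSeq_sig (m + 1)).comm _ _ (by omega) (by omega)
    exact (hc.inv_right.mul_right (hk.mul_right hk)).mul_right hc
  · have hM := sig_mul_moveLast (m := m) (i := i) (k := k + 1) (by omega) (by omega)
    have hi' : sig (m + 1) i =
        (moveLast m (k + 1))⁻¹ * sig (m + 1) (i + 1) * moveLast m (k + 1) := by
      rw [mul_assoc, hM]
      group
    have hk : Commute (sig (m + 1) (i + 1)) (sig (m + 1) k) :=
      ((isBraidSeq_sig (m + 1)).comm _ _ (by omega) (by omega)).symm
    rw [hi', braidLoop]
    simpa [MulAut.conj_apply] using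
      (hk.mul_right hk).map (MulAut.conj (moveLast m (k + 1))⁻¹).toMonoidHom

theorem conj_braidLoop {i : ℕ} (hi : i + 1 < m) :
    ∃ g a b : BraidGroup (m + 1), a * b * a = b * a * b ∧ sig (m + 1) i = g⁻¹ * a * g ∧
      braidLoop m i = g⁻¹ * (b⁻¹ * (a * a) * b) * g ∧ braidLoop m (i + 1) = g⁻¹ * (b * b) * g := by
  refine ⟨moveLast m (i + 1 + 1), sig (m + 1) i, sig (m + 1) (i + 1),
    (isBraidSeq_sig (m + 1)).braid i (by omega), ?_, ?_, rfl⟩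
  · rw [mul_assoc, (commute_sig_moveLast (by omega)).eq]
    group
  · rw [braidLoop, moveLast_of_lt (by omega)]
    group

theorem sig_mul_braidLoop_succ {i : ℕ} (hi : i + 1 < m) :
    sig (m + 1) i * braidLoop m (i + 1) = braidLoop m i * sig (m + 1) i := by
  obtain ⟨g, a, b, h, h1, h2, h3⟩ := conj_braidLoop hi
  rw [h1, h2, h3]
  have e : a * b * b = b⁻¹ * a * a * b * a := by
    calc a * b * b = b⁻¹ * (b * a * b) * b := by group
      _ = b⁻¹ * (a * b * a) * b := by rw [h]
      _ = b⁻¹ * a * (b * a * b) := by group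
      _ = _ := by rw [← h]; group
  calc g⁻¹ * a * g * (g⁻¹ * (b * b) * g) = g⁻¹ * (a * b * b) * g := by group
    _ = _ := by rw [e]; group

theorem sig_mul_braidLoop_self {i : ℕ} (hi : i + 1 < m) :
    sig (m + 1) i * braidLoop m i =
      (braidLoop m i)⁻¹ * braidLoop m (i + 1) * braidLoop m i * sig (m + 1) i := by
  -- the product `x_{i+1} x_i` commutes with `σ_i`, which conjugates `x_{i+1}` into `x_i`
  have hc : sig (m + 1) i * (braidLoop m (i + 1) * braidLoop m i) =
      braidLoop m (i + 1) * braidLoop m i * sig (m + 1) i := by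
    obtain ⟨g, a, b, h, h1, h2, h3⟩ := conj_braidLoop hi
    rw [h1, h2, h3]
    have e : a * b * a * a * b = b * a * a * b * a := by
      calc a * b * a * a * b = b * a * (b * a * b) := by rw [h]; group
        _ = _ := by rw [← h]; group
    calc g⁻¹ * a * g * (g⁻¹ * (b * b) * g * (g⁻¹ * (b⁻¹ * (a * a) * b) * g))
        = g⁻¹ * (a * b * a * a * b) * g := by group
      _ = _ := by rw [e]; group
  rw [← mul_assoc, sig_mul_braidLoop_succ hi] at hc
  rw [mul_assoc, mul_assoc, ← mul_assoc (braidLoop m (i + 1)), ← hc]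
  group

end Move

section CombToBraid

open CombGroup

variable {m : ℕ}

theorem isBraidSeq_sig_succ (m : ℕ) : IsBraidSeq (m - 1) (sig (m + 1)) where
  comm i j hij hj := (isBraidSeq_sig (m + 1)).comm i j hij (by omega)
  braid i hi := (isBraidSeq_sig (m + 1)).braid i (by omega)

/-- The homomorphism `B_m → B_{m+1}` which adds a last strand. -/
def braidIncl (m : ℕ) : BraidGroup m →* BraidGroup (m + 1) := braidLift (isBraidSeq_sig_succ m)

theorem braidIncl_sig {i : ℕ} (hi : i < m - 1) : braidIncl m (sig m i) = sig (m + 1) i :=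
  braidLift_sig _ hi

/-- The homomorphism from the free group to `B_{m+1}` whose image consists of the pure braids that
become trivial when the last strand is removed. -/
def loopHom (m : ℕ) : FreeGroup (Fin m) →* BraidGroup (m + 1) :=
  FreeGroup.lift fun k => braidLoop m k

theorem loopHom_artinHom (b : BraidGroup m) (f : FreeGroup (Fin m)) :
    loopHom m (artinHom m b f) = braidIncl m b * loopHom m f * (braidIncl m b)⁻¹ := by
  induction b using braid_induction generalizing f with
  | sig i hi =>
    have e : artinHom m (sig m i) = artinSeq m i := braidLift_sig _ hi
    rw [e, braidIncl_sig hi]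
    suffices H : (loopHom m).comp (artinSeq m i).toMonoidHom =
        (MulAut.conj (sig (m + 1) i)).toMonoidHom.comp (loopHom m) from DFunLike.congr_fun H f
    ext k
    have h0 : loopHom m (artinSeq m i (FreeGroup.of k)) * sig (m + 1) i =
        sig (m + 1) i * braidLoop m k := by
      rw [artinSeq, dif_pos hi, artinAut_of]
      obtain ⟨k, hk⟩ := k
      simp only [Fin.ext_iff]
      split_ifs with h1 h2
      · subst h1
        simp [loopHom, sig_mul_braidLoop_succ (show i + 1 < m by omega)]
      · subst h2
        simp [loopHom, sig_mul_braidLoop_self (show k + 1 < m by omega)]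
      · simp [loopHom, sig_mul_braidLoop_of_ne hi hk h2 h1]
    simpa [loopHom] using eq_mul_inv_of_mul_eq h0
  | one => simp
  | mul a b ha hb =>
    rw [map_mul, MulAut.mul_apply, ha, hb, map_mul]
    group
  | inv a ha =>
    have h := ha ((artinHom m a)⁻¹ f)
    rw [MulAut.apply_inv_self] at h
    rw [map_inv, h, map_inv]
    group

/-- The homomorphism from the model `CombGroup m` onto the stabiliser of the last strand
in `B_{m+1}`. -/
def combToBraid (m : ℕ) : CombGroup m →* BraidGroup (m + 1) :=
  SemidirectProduct.lift (loopHom m) (braidIncl m) fun b => by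
    ext1 f
    exact loopHom_artinHom b _

theorem combToBraid_sigma {i : ℕ} (hi : i < m - 1) :
    combToBraid m (sigma m i) = sig (m + 1) i := by
  rw [combToBraid, sigma, SemidirectProduct.lift_inr, braidIncl_sig hi]

theorem combToBraid_loop {k : ℕ} (hk : k < m) : combToBraid m (loop m k) = braidLoop m k := by
  rw [combToBraid, loop_of_lt hk, SemidirectProduct.lift_inl, loopHom, FreeGroup.lift_apply_of]

theorem sig_mul_moveLast_eq {i k : ℕ} (hi : i < m) (hk : k < m + 1) :
    sig (m + 1) i * moveLast m k =
      moveLast m (swapSeq (m + 1) i ⟨k, hk⟩) * combToBraid m (combFactor m i k) := by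
  rw [coe_swapSeq_apply (show i < m + 1 - 1 from hi)]
  dsimp only
  split_ifs with h1 h2
  · subst h1
    rw [combFactor_self rfl, combToBraid_loop hi, braidLoop, moveLast_of_lt hi]
    group
  · rw [combFactor_succ h2.symm, map_one, mul_one, moveLast_of_lt hi, h2]
  · rcases Nat.lt_or_ge (i + 1) k with h | h
    · rw [combFactor_lt h, combToBraid_sigma (by omega), (commute_sig_moveLast h).eq]
    · obtain ⟨j, rfl⟩ : ∃ j, i = j + 1 := ⟨i - 1, by omega⟩
      rw [combFactor_gt (by omega), Nat.add_sub_cancel (n := j) (m := 1),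
        combToBraid_sigma (by omega),
        sig_mul_moveLast (by omega) hi]

/-- The map `(k, h) ↦ M_k h` is equivariant. -/
theorem mul_moveLast_mul_combToBraid (b : BraidGroup (m + 1)) (x : Fin (m + 1) × CombGroup m) :
    b * (moveLast m x.1 * combToBraid m x.2) =
      moveLast m (combAction m b x).1 * combToBraid m (combAction m b x).2 := by
  induction b using braid_induction generalizing x with
  | sig i hi =>
    obtain ⟨k, h⟩ := x
    rw [combAction_sig (show i < m from hi), ← mul_assoc,
      sig_mul_moveLast_eq (show i < m from hi) k.2, map_mul, mul_assoc]
  | one => simp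
  | mul a b ha hb => rw [map_mul, Equiv.Perm.mul_apply, ← ha, ← hb, mul_assoc]
  | inv a ha =>
    have h := ha ((combAction m a).symm x)
    rw [Equiv.apply_symm_apply] at h
    rw [← h, map_inv, Equiv.Perm.inv_def]
    group

theorem exists_combToBraid_eq {b : BraidGroup (m + 1)}
    (hb : braidPerm (m + 1) b (Fin.last m) = Fin.last m) : ∃ h, combToBraid m h = b := by
  have h := mul_moveLast_mul_combToBraid b (Fin.last m, 1)
  rw [combAction_apply, hb] at h
  refine ⟨combCocycle m b (Fin.last m), ?_⟩
  simpa [moveLast_of_ge le_rfl] using h.symm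

theorem combAction_moveLast {k : ℕ} (hk : k < m + 1) (g : CombGroup m) :
    combAction m (moveLast m k) (Fin.last m, g) = (⟨k, hk⟩, g) := by
  obtain ⟨d, hd⟩ : ∃ d, d = m - k := ⟨_, rfl⟩
  induction d generalizing k with
  | zero =>
    obtain rfl : k = m := by omega
    rw [moveLast_of_ge le_rfl]
    simp [Fin.last]
  | succ d ih =>
    rw [moveLast_of_lt (by omega), map_mul, Equiv.Perm.mul_apply, ih (by omega) (by omega),
      combAction_sig (by omega), combFactor_succ rfl, one_mul]
    congr 1
    ext
    rw [coe_swapSeq_apply (by omega)]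
    simp

theorem combAction_braidLoop {k : ℕ} (hk : k < m) (g : CombGroup m) :
    combAction m (braidLoop m k) (Fin.last m, g) = (Fin.last m, loop m k * g) := by
  have e1 : swapSeq (m + 1) k ⟨k + 1, by omega⟩ = ⟨k, by omega⟩ := by
    ext
    rw [coe_swapSeq_apply (show k < m + 1 - 1 from hk)]
    simp
  have e2 : swapSeq (m + 1) k ⟨k, by omega⟩ = ⟨k + 1, by omega⟩ := by
    ext
    rw [coe_swapSeq_apply (show k < m + 1 - 1 from hk)]
    simp
  rw [braidLoop, map_mul, map_mul, map_mul, map_inv, Equiv.Perm.mul_apply, Equiv.Perm.mul_apply,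
    Equiv.Perm.mul_apply, Equiv.Perm.inv_eq_iff_eq, combAction_moveLast (by omega),
    combAction_moveLast (by omega), combAction_sig hk ⟨k + 1, by omega⟩ g, combFactor_succ rfl, e1,
    combAction_sig hk,
    combFactor_self rfl, e2, one_mul]

theorem combAction_combToBraid (h g : CombGroup m) :
    combAction m (combToBraid m h) (Fin.last m, g) = (Fin.last m, h * g) := by
  have hmul : ∀ a b : CombGroup m,
      (∀ g, combAction m (combToBraid m a) (Fin.last m, g) = (Fin.last m, a * g)) →
      (∀ g, combAction m (combToBraid m b) (Fin.last m, g) = (Fin.last m, b * g)) →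
      ∀ g, combAction m (combToBraid m (a * b)) (Fin.last m, g) = (Fin.last m, a * b * g) := by
    intro a b ha hb g
    rw [map_mul, map_mul, Equiv.Perm.mul_apply, hb, ha, mul_assoc]
  have hinv : ∀ a : CombGroup m,
      (∀ g, combAction m (combToBraid m a) (Fin.last m, g) = (Fin.last m, a * g)) →
      ∀ g, combAction m (combToBraid m a⁻¹) (Fin.last m, g) = (Fin.last m, a⁻¹ * g) := by
    intro a ha g
    rw [map_inv, map_inv, Equiv.Perm.inv_eq_iff_eq, ha]
    simp
  rw [← SemidirectProduct.inl_left_mul_inr_right h]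
  refine hmul _ _ ?_ ?_ g
  · induction h.left using FreeGroup.induction_on with
    | C1 => simp
    | of k =>
      intro g
      rw [← loop_of_lt k.2, combToBraid_loop k.2, combAction_braidLoop k.2]
    | inv_of k ih => rw [map_inv]; exact hinv _ ih
    | mul a b ha hb => rw [map_mul]; exact hmul _ _ ha hb
  · induction h.right using braid_induction with
    | sig i hi =>
      intro g
      have e : swapSeq (m + 1) i (Fin.last m) = Fin.last m := by
        ext
        rw [coe_swapSeq_apply (by omega), if_neg, if_neg] <;> simp <;> omega
      change combAction m (combToBraid m (sigma m i)) (Fin.last m, g) = (_, sigma m i * g)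
      rw [combToBraid_sigma hi, combAction_sig (by omega), e, combFactor_lt]
      simp
      omega
    | one => simp
    | mul a b ha hb => rw [map_mul]; exact hmul _ _ ha hb
    | inv a ih => rw [map_inv]; exact hinv _ ih

theorem combToBraid_injective (m : ℕ) : Function.Injective (combToBraid m) := by
  intro a b hab
  have h := combAction_combToBraid a 1
  rw [hab, combAction_combToBraid] at h
  simpa using (congrArg Prod.snd h).symm

end CombToBraid

/-! ### The centraliser of the pure braid group -/

section Centraliser

open CombGroup

variable {m : ℕ}

theorem braidPerm_braidIncl_castSucc (b : BraidGroup m) (k : Fin m) :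
    braidPerm (m + 1) (braidIncl m b) k.castSucc = (braidPerm m b k).castSucc := by
  induction b using braid_induction generalizing k with
  | sig i hi =>
    rw [braidIncl_sig hi, braidPerm_sig, braidPerm_sig]
    ext
    rw [Fin.val_castSucc, coe_swapSeq_apply hi, coe_swapSeq_apply (by omega)]
    rfl
  | one => simp
  | mul a b ha hb => simp only [map_mul, Equiv.Perm.mul_apply, hb, ha]
  | inv a ha => rw [map_inv, map_inv, Equiv.Perm.inv_eq_iff_eq, map_inv, ha]; simp

theorem braidPerm_braidIncl_last (b : BraidGroup m) :
    braidPerm (m + 1) (braidIncl m b) (Fin.last m) = Fin.last m := by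
  have h := combAction_combToBraid (SemidirectProduct.inr b) (1 : CombGroup m)
  rw [combAction_apply] at h
  simpa [combToBraid] using congrArg Prod.fst h

theorem braidIncl_mem_pureBraidGroup_iff {b : BraidGroup m} :
    braidIncl m b ∈ pureBraidGroup (m + 1) ↔ b ∈ pureBraidGroup m := by
  simp only [pureBraidGroup, MonoidHom.mem_ker]
  constructor
  · intro h
    ext1 k
    have := braidPerm_braidIncl_castSucc b k
    rw [h] at this
    exact (Fin.castSucc_injective _ this).symm
  · intro h
    ext1 k
    induction k using Fin.lastCases with
    | last => exact braidPerm_braidIncl_last b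
    | cast k => rw [braidPerm_braidIncl_castSucc, h]; rfl

theorem loopHom_mem_pureBraidGroup (f : FreeGroup (Fin m)) :
    loopHom m f ∈ pureBraidGroup (m + 1) := by
  have h : (loopHom m).range ≤ pureBraidGroup (m + 1) := by
    refine FreeGroup.range_lift_le ?_
    rintro _ ⟨k, rfl⟩
    have hn : (pureBraidGroup (m + 1)).Normal := MonoidHom.normal_ker _
    simpa [braidLoop] using
      hn.conj_mem _ (sig_sq_mem_pureBraidGroup (m + 1) k) (moveLast m (k + 1))⁻¹
  exact h ⟨f, rfl⟩

theorem ascProd_mul_moveLast {k : ℕ} (hk : k ≤ m) :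
    ascProd (sig (m + 1)) k * moveLast m k = moveLast m 0 := by
  induction k with
  | zero => simp [ascProd]
  | succ k ih => rw [← ih (by omega), ascProd, moveLast_of_lt (k := k) (by omega), mul_assoc]

theorem descProd_mul_ascProd_mem_range_loopHom (m : ℕ) :
    descProd (sig (m + 1)) m * ascProd (sig (m + 1)) m ∈ (loopHom m).range := by
  -- `σ_{m-1} ⋯ σ_k σ_k ⋯ σ_{m-1}` is a product of loops, by descending induction on `k`
  have H : ∀ d k, k + d = m →
      descProd (sig (m + 1)) m * (descProd (sig (m + 1)) k)⁻¹ * moveLast m k ∈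
        (loopHom m).range := by
    intro d
    induction d with
    | zero =>
      intro k hk
      obtain rfl : k = m := hk
      rw [moveLast_of_ge le_rfl]
      simp
    | succ d ih =>
      intro k hk
      have hx : braidLoop m k ∈ (loopHom m).range :=
        ⟨FreeGroup.of ⟨k, by omega⟩, by simp [loopHom]⟩
      convert mul_mem (ih (k + 1) (by omega)) hx using 1
      rw [moveLast_of_lt (by omega), braidLoop, descProd]
      group
  have h := H m 0 (by omega)
  have hA := ascProd_mul_moveLast (le_refl m)
  rw [moveLast_of_ge le_rfl, mul_one] at hA
  rw [hA]
  simpa [descProd] using h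

/-- The full twist on `m + 1` strands is the full twist on the first `m` strands times a
braid in which only the last strand moves, once around all the others. -/
theorem exists_combToBraid_eq_halfTwist_sq (hm : 1 ≤ m) :
    ∃ f, combToBraid m (SemidirectProduct.inl f * SemidirectProduct.inr (halfTwist m ^ 2)) =
      halfTwist (m + 1) ^ 2 := by
  obtain ⟨f, hf⟩ := descProd_mul_ascProd_mem_range_loopHom m
  refine ⟨f, ?_⟩
  rw [map_mul, combToBraid, SemidirectProduct.lift_inl, SemidirectProduct.lift_inr, hf,
    halfTwist_eq hm, halfTwist_eq (by omega), map_pow,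
    map_garside (braidIncl m) fun i hi => braidIncl_sig (by omega)]
  exact ((isBraidSeq_sig (m + 1)).garside_succ_sq le_rfl).symm

theorem expSum_right_combCocycle_sig_sq {i : ℕ} (hi : i < m) (k : Fin (m + 1)) :
    expSum m (combCocycle m (sig (m + 1) i * sig (m + 1) i) k).right =
      if (k : ℕ) = i ∨ (k : ℕ) = i + 1 then 1 else Multiplicative.ofAdd 2 := by
  rw [combCocycle_mul, combCocycle_sig hi, combCocycle_sig hi, braidPerm_sig,
    coe_swapSeq_apply (show i < m + 1 - 1 from hi)]
  obtain ⟨k, hk⟩ := k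
  dsimp only
  by_cases h1 : k = i
  · rw [if_pos h1, if_pos (Or.inl h1), combFactor_succ rfl, combFactor_self h1.symm,
      loop_of_lt (by omega)]
    simp
  by_cases h2 : k = i + 1
  · rw [if_neg h1, if_pos h2, if_pos (Or.inr h2), combFactor_self rfl, combFactor_succ h2.symm,
      loop_of_lt hi]
    simp
  · rw [if_neg h1, if_neg h2, if_neg (by omega)]
    have e : ∃ j < m - 1, combFactor m i k = sigma m j := by
      rcases Nat.lt_or_ge (i + 1) k with h | h
      · exact ⟨i, by omega, combFactor_lt h⟩
      · exact ⟨i - 1, by omega, combFactor_gt (by omega)⟩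
    obtain ⟨j, hj, e⟩ := e
    rw [e, SemidirectProduct.mul_right, sigma, SemidirectProduct.right_inr, map_mul,
      expSum_sig hj]
    rfl

/-- A braid on at least three strands which centralises the pure braids is pure. The cocycle of
`σ_i ^ 2` at position `k` has exponent sum `0` if `k` is `i` or `i + 1`, and `2` otherwise; as `z`
commutes with `σ_i ^ 2`, these exponent sums agree at `k` and at its image under `z`. -/
theorem mem_pureBraidGroup_of_centralises {n : ℕ} (hn : 3 ≤ n) {z : BraidGroup n}
    (hz : ∀ p ∈ pureBraidGroup n, p * z = z * p) : z ∈ pureBraidGroup n := by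
  obtain ⟨m, rfl⟩ : ∃ m, n = m + 1 := ⟨n - 1, by omega⟩
  rw [pureBraidGroup, MonoidHom.mem_ker]
  ext1 k
  have key : ∀ i < m, ((braidPerm (m + 1) z k : ℕ) = i ∨ (braidPerm (m + 1) z k : ℕ) = i + 1) ↔
      ((k : ℕ) = i ∨ (k : ℕ) = i + 1) := by
    intro i hi
    have hp := sig_sq_mem_pureBraidGroup (m + 1) i
    have h := congrArg (fun b => expSum m (combCocycle m b k).right) (hz _ hp)
    have hp1 : braidPerm (m + 1) (sig (m + 1) i * sig (m + 1) i) = 1 := hp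
    simp only [combCocycle_mul _ z, combCocycle_mul z, SemidirectProduct.mul_right, map_mul, hp1,
      Equiv.Perm.one_apply] at h
    rw [mul_comm, mul_left_cancel_iff, expSum_right_combCocycle_sig_sq hi,
      expSum_right_combCocycle_sig_sq hi] at h
    have h2 : (1 : Multiplicative ℤ) ≠ Multiplicative.ofAdd 2 := by decide
    split_ifs at h with h3 h4 h4
    · exact ⟨fun _ => h4, fun _ => h3⟩
    · exact absurd h h2
    · exact absurd h.symm h2
    · exact ⟨fun h => absurd h h3, fun h => absurd h h4⟩
  rw [Equiv.Perm.one_apply, Fin.ext_iff]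
  have h1 := (braidPerm (m + 1) z k).2
  have h2 := k.2
  have k1 := key k
  have k2 := key (k - 1)
  have k3 := key (braidPerm (m + 1) z k)
  have k4 := key (braidPerm (m + 1) z k - 1)
  omega

theorem mem_zpowers_sig_two (z : BraidGroup 2) : z ∈ Subgroup.zpowers (sig 2 0) := by
  induction z using braid_induction with
  | sig i hi =>
    obtain rfl : i = 0 := by omega
    exact Subgroup.mem_zpowers _
  | one => exact one_mem _
  | mul a b ha hb => exact mul_mem ha hb
  | inv a ha => exact inv_mem ha

theorem halfTwist_two : halfTwist 2 = sig 2 0 := by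
  rw [halfTwist_eq (by omega)]
  simp [garside, ascProd]

theorem pureBraidGroup_two_le : pureBraidGroup 2 ≤ Subgroup.zpowers (halfTwist 2 ^ 2) := by
  intro z hz
  obtain ⟨k, rfl⟩ := mem_zpowers_sig_two z
  rw [pureBraidGroup, MonoidHom.mem_ker] at hz
  have hsq : swapSeq 2 0 ^ 2 = 1 := by rw [sq, swapSeq_sq]
  rcases Int.even_or_odd' k with ⟨j, rfl | rfl⟩
  · refine ⟨j, ?_⟩
    simp only [halfTwist_two]
    rw [← zpow_natCast, ← zpow_mul]
    rfl
  · simp only [map_zpow, braidPerm_sig] at hz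
    rw [zpow_add, zpow_mul, zpow_ofNat, hsq, one_zpow, one_mul, zpow_one] at hz
    have h := coe_swapSeq_apply (n := 2) (i := 0) (by omega) 0
    rw [hz] at h
    simp at h

/-- A pure braid that centralises the pure braid group is a power of the full twist. Removing the
last strand reduces this to fewer strands, up to a factor in the free group of loops; this factor
centralises the free group, which has rank at least two. -/
theorem mem_zpowers_of_mem_pureBraidGroup {n : ℕ} (hn : 2 ≤ n) {z : BraidGroup n}
    (hz : z ∈ pureBraidGroup n) (hc : ∀ p ∈ pureBraidGroup n, p * z = z * p) :
    z ∈ Subgroup.zpowers (halfTwist n ^ 2) := by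
  induction n, hn using Nat.le_induction with
  | base => exact pureBraidGroup_two_le hz
  | succ m hm ih =>
    have hz1 : braidPerm (m + 1) z = 1 := hz
    obtain ⟨h, rfl⟩ := exists_combToBraid_eq (b := z) (by rw [hz1]; rfl)
    have hinr : ∀ b, combToBraid m (SemidirectProduct.inr b) = braidIncl m b := fun b => by
      rw [combToBraid, SemidirectProduct.lift_inr]
    have hinl : ∀ f, combToBraid m (SemidirectProduct.inl f) = loopHom m f := fun f => by
      rw [combToBraid, SemidirectProduct.lift_inl]
    have hright : h.right ∈ Subgroup.zpowers (halfTwist m ^ 2) := by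
      refine ih ?_ fun p hp => ?_
      · rw [← braidIncl_mem_pureBraidGroup_iff, ← hinr]
        rw [← SemidirectProduct.inl_left_mul_inr_right h, map_mul, hinl] at hz
        exact (Subgroup.mul_mem_cancel_left _ (loopHom_mem_pureBraidGroup _)).1 hz
      · have h1 := hc _ (braidIncl_mem_pureBraidGroup_iff.2 hp)
        rw [← hinr, ← map_mul, ← map_mul] at h1
        exact congrArg SemidirectProduct.right (combToBraid_injective m h1)
    obtain ⟨k, hk⟩ := hright
    obtain ⟨f, hf⟩ := exists_combToBraid_eq_halfTwist_sq (m := m) (by omega)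
    set t : CombGroup m := SemidirectProduct.inl f * SemidirectProduct.inr (halfTwist m ^ 2)
      with ht
    have htr : SemidirectProduct.rightHom t = halfTwist m ^ 2 := by
      rw [ht, map_mul, SemidirectProduct.rightHom_inl, SemidirectProduct.rightHom_inr, one_mul]
    have hu : SemidirectProduct.rightHom (h * (t ^ k)⁻¹) = 1 := by
      rw [map_mul, map_inv, map_zpow, htr]
      exact mul_inv_eq_one.2 hk.symm
    rw [← MonoidHom.mem_ker, ← SemidirectProduct.range_inl_eq_ker_rightHom] at hu
    obtain ⟨u, hu⟩ := hu
    have : Nontrivial (Fin m) := Fin.nontrivial_iff_two_le.2 hm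
    have hu1 : u = 1 := by
      refine FreeGroup.eq_one_of_commute_of fun a => ?_
      refine SemidirectProduct.inl_injective (φ := artinHom m) (combToBraid_injective m ?_)
      have h1 := hc _ (loopHom_mem_pureBraidGroup (FreeGroup.of a))
      have h2 := Subgroup.mem_center_iff.1
        (zpow_mem (halfTwist_sq_mem_center (n := m + 1) (by omega)) k) (loopHom m (FreeGroup.of a))
      rw [map_mul, map_mul, map_mul, map_mul, hu, map_mul, map_inv, map_zpow, hf, hinl]
      exact (Commute.mul_left h1.symm (Commute.inv_right h2).symm).eq
    refine ⟨k, ?_⟩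
    rw [hu1, map_one, eq_comm, mul_inv_eq_one] at hu
    change (halfTwist (m + 1) ^ 2) ^ k = _
    rw [hu, map_zpow, hf]

end Centraliser

/-! ### The centres -/

theorem mem_centreIn {A : Type*} [Group A] {H : Subgroup A} {x : A} :
    x ∈ centreIn H ↔ x ∈ H ∧ ∀ y ∈ H, y * x = x * y := by
  constructor
  · rintro ⟨z, hz, rfl⟩
    exact ⟨z.2, fun y hy => congrArg Subtype.val (Subgroup.mem_center_iff.1 hz ⟨y, hy⟩)⟩
  · rintro ⟨hx, h⟩
    exact ⟨⟨x, hx⟩, Subgroup.mem_center_iff.2 fun y => Subtype.ext (h y y.2), rfl⟩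

theorem halfTwist_sq_mem_centreIn {n : ℕ} (hn : 2 ≤ n) {H : Subgroup (BraidGroup n)}
    (hH : pureBraidGroup n ≤ H) : halfTwist n ^ 2 ∈ centreIn H :=
  mem_centreIn.2 ⟨hH (halfTwist_sq_mem_pureBraidGroup (by omega)), fun y _ =>
    Subgroup.mem_center_iff.1 (halfTwist_sq_mem_center (by omega)) y⟩

theorem centreIn_eq_zpowers {n : ℕ} (hn : 3 ≤ n) {H : Subgroup (BraidGroup n)}
    (hH : pureBraidGroup n ≤ H) : centreIn H = Subgroup.zpowers (halfTwist n ^ 2) := by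
  refine le_antisymm (fun z hz => ?_)
    (Subgroup.zpowers_le.2 (halfTwist_sq_mem_centreIn (by omega) hH))
  have hc : ∀ p ∈ pureBraidGroup n, p * z = z * p := fun p hp => (mem_centreIn.1 hz).2 p (hH hp)
  exact mem_zpowers_of_mem_pureBraidGroup (by omega) (mem_pureBraidGroup_of_centralises hn hc) hc

theorem infinite_center {n : ℕ} (hn : 2 ≤ n) {H : Subgroup (BraidGroup n)}
    (hH : pureBraidGroup n ≤ H) : Infinite (Subgroup.center H) := by
  obtain ⟨c, hc, hcz⟩ := halfTwist_sq_mem_centreIn hn hH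
  refine Infinite.of_injective (fun k : ℤ => (⟨c, hc⟩ : Subgroup.center H) ^ k) fun a b hab => ?_
  refine halfTwist_sq_zpow_injective hn ?_
  have h := congrArg (fun x : Subgroup.center H => ((x : H) : BraidGroup n)) hab
  simpa [← hcz] using h

theorem isCyclic_center {n : ℕ} (hn : 2 ≤ n) {H : Subgroup (BraidGroup n)}
    (hH : pureBraidGroup n ≤ H) : IsCyclic (Subgroup.center H) := by
  rcases Nat.eq_or_lt_of_le hn with rfl | hn
  · have : IsCyclic (BraidGroup 2) := ⟨_, mem_zpowers_sig_two⟩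
    infer_instance
  · have e := (Subgroup.center H).equivMapOfInjective H.subtype H.subtype_injective
    have : IsCyclic (centreIn H) := by
      rw [centreIn_eq_zpowers hn hH]
      infer_instance
    exact e.isCyclic.2 this

theorem mainTheorem7 (n : ℕ) (hn : 2 ≤ n) (G : Subgroup (Equiv.Perm (Fin n))) :
    (IsCyclic (Subgroup.center (gBraidGroup G)) ∧
      Infinite (Subgroup.center (gBraidGroup G))) ∧
    (3 ≤ n →
      centreIn (pureBraidGroup n) = centreIn (gBraidGroup G) ∧
      centreIn (gBraidGroup G) = Subgroup.center (BraidGroup n) ∧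
      Subgroup.center (BraidGroup n) = Subgroup.zpowers (halfTwist n ^ 2) ∧
      halfTwist n ^ 2 = ascendingBraid n (n - 1) ^ n) := by
  have hG : pureBraidGroup n ≤ gBraidGroup G := (braidPerm n).ker_le_comap G
  refine ⟨⟨isCyclic_center hn hG, infinite_center hn hG⟩, fun h3 => ?_⟩
  have htop : Subgroup.center (BraidGroup n) = Subgroup.zpowers (halfTwist n ^ 2) := by
    rw [← centreIn_eq_zpowers h3 le_top]
    ext z
    simp [mem_centreIn, Subgroup.mem_center_iff]
  refine ⟨?_, ?_, htop, halfTwist_sq_eq (by omega)⟩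
  · rw [centreIn_eq_zpowers h3 le_rfl, centreIn_eq_zpowers h3 hG]
  · rw [htop, centreIn_eq_zpowers h3 hG]
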